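/- Let $Y$ be a two-sided exponential random variable, i.e. a real random variable with law $\nu(dy)=\tfrac12 e^{-|y|}\,dy$ on $\mathbb{R}$, let $p>0$, and set $X=\operatorname{sign}(Y)\,|Y|^p$. Let $X_1,X_2,\dots$ be independent random variables with the same law as $X$, defined on a probability space with probability $\mathbb{P}$, and let $S_n=\frac1n\sum_{i=1}^n X_i$. We say that $(S_n)_{n\ge1}$ satisfies a large deviations principle at speed $v_n$ with rate function $I:\mathbb{R}\to[0,+\infty]$ if $I$ is lower semicontinuous and, for every Borel set $B\subset\mathbb{R}$, $$-\inf_{\mathring B} I\;\le\;\liminf_{n\to\infty}\frac1{v_n}\log\mathbb{P}(S_n\in B)\;\le\;\limsup_{n\to\infty}\frac1{v_n}\log\mathbb{P}(S_n\in B)\;\le\;-\inf_{\overline B} I,$$ where $\mathring B$ and $\overline B$ are the interior and the closure of $B$, $\log 0=-\infty$ and $\inf_\emptyset I=+\infty$. 1. If $p\in(0,1]$, then $(S_n)_{n\ge1}$ satisfies a large deviations principle at speed $n$ with rate function $$J(x)=\sup_{\eta\in\mathbb{R}}\{\eta x-\lambda(\eta)\},\qquad \lambda(\eta)=\log\mathbb{E}\big[e^{\eta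 X}\big]\in(-\infty,+\infty].$$ 2. If $p>1$, then $(S_n)_{n\ge1}$ satisfies a large deviations principle at speed $n^{1/p}$ with rate function $I_{1/p}(x)=|x|^{1/p}$. -/

import Mathlib

open MeasureTheory ProbabilityTheory Filter
open scoped ENNReal

noncomputable section

/-- The sequence `Z` of random variables on `(Ω, P)` satisfies a large deviations principle at
speed `v` with rate function `I`. Probabilities and their logarithms are extended-valued:
`log 0 = -∞`, and the infimum of `I` over the empty set is `+∞`. -/
def SatisfiesLDP {Ω S : Type*} [MeasurableSpace Ω] (P : Measure Ω)
    [TopologicalSpace S] [MeasurableSpace S] [BorelSpace S]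
    (Z : ℕ → Ω → S) (v : ℕ → ℝ) (I : S → EReal) : Prop :=
  (∀ z, 0 ≤ I z) ∧ LowerSemicontinuous I ∧
    ∀ B : Set S, MeasurableSet B →
      -(⨅ z ∈ interior B, I z) ≤
          liminf (fun n : ℕ => ENNReal.log (P {ω | Z n ω ∈ B}) / ((v n : ℝ) : EReal)) atTop ∧
        limsup (fun n : ℕ => ENNReal.log (P {ω | Z n ω ∈ B}) / ((v n : ℝ) : EReal)) atTop ≤
          -(⨅ z ∈ closure B, I z)

/-- The signed power `φ_p(x) = sign(x) |x|^p`. -/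
def signedPow (p x : ℝ) : ℝ := Real.sign x * |x| ^ p

/-- The two-sided exponential distribution `ν(dy) = (e^{-|y|} / 2) dy` on `ℝ`. -/
def twoSidedExponential : Measure ℝ :=
  volume.withDensity fun y => ENNReal.ofReal (Real.exp (-|y|) / 2)

/-- The empirical mean of the first `n` samples. -/
def empiricalMean {Ω : Type*} (X : ℕ → Ω → ℝ) (n : ℕ) (ω : Ω) : ℝ :=
  (1 / (n : ℝ)) * ∑ i ∈ Finset.range n, X i ω

/-- The free energy `λ(η) = log E[e^{η X}]`, equal to `+∞` where the expectation is infinite. -/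
def freeEnergy {Ω : Type*} [MeasurableSpace Ω] (P : Measure Ω) (X : Ω → ℝ) (η : ℝ) : EReal :=
  ENNReal.log (∫⁻ ω, ENNReal.ofReal (Real.exp (η * X ω)) ∂P)

/-- The Legendre transform `x ↦ sup_η {η x - L(η)}`. -/
def legendre (L : ℝ → EReal) (x : ℝ) : EReal :=
  ⨆ η : ℝ, (((η * x : ℝ) : EReal) - L η)

end

/-!
The upper bound is a union of two half-line tails, the lower bound a local estimate on small balls.

For `p ≤ 1` the cumulant generating function of `X` is steep at the boundary of its domain, so
every `x ∈ ℝ` is the mean of an exponential tilting of the law of `X`. Chernoff's inequality bounds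
the tails, and Chebyshev's inequality under the tilted law bounds the mass near `x` from below.

For `p > 1` put `α = 1 / p`, so that `|X| ^ α` is exponentially distributed and a single summand
exceeds `n b` with probability about `exp (-(n b) ^ α)`. This is the most likely way for the mean
to exceed `b`: once the summands are truncated at `n b`, Chernoff's inequality with the vanishing
parameter `θ (n b) ^ (α - 1)`, for any `θ < 1`, gives a bound of the same order, because the cost of
the centred truncated variables is quadratic in the parameter. Conversely, one summand near `n x`
and the others with a small sum, which has probability close to one by Chebyshev's inequality, put
the mean near `x`.
-/

section LargeDeviations

theorem log_measure_div_le_coe_iff {Ω : Type*} [MeasurableSpace Ω] {P : Measure Ω}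
    [IsFiniteMeasure P] {A : Set Ω} {v c : ℝ} (hv : 0 < v) :
    ENNReal.log (P A) / (v : EReal) ≤ (c : EReal) ↔ P.real A ≤ Real.exp (c * v) := by
  rw [EReal.div_le_iff_le_mul (EReal.coe_pos.2 hv) (EReal.coe_ne_top v), mul_comm,
    ← EReal.coe_mul, ← Real.log_exp (c * v), ← ENNReal.log_ofReal_of_pos (Real.exp_pos _),
    ENNReal.log_le_log_iff, ← ofReal_measureReal,
    ENNReal.ofReal_le_ofReal_iff (Real.exp_nonneg _), Real.log_exp]

theorem coe_le_log_measure_div_iff {Ω : Type*} [MeasurableSpace Ω] {P : Measure Ω}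
    [IsFiniteMeasure P] {A : Set Ω} {v c : ℝ} (hv : 0 < v) :
    (c : EReal) ≤ ENNReal.log (P A) / (v : EReal) ↔ Real.exp (c * v) ≤ P.real A := by
  rw [EReal.le_div_iff_mul_le (EReal.coe_pos.2 hv) (EReal.coe_ne_top v),
    ← EReal.coe_mul, ← Real.log_exp (c * v), ← ENNReal.log_ofReal_of_pos (Real.exp_pos _),
    ENNReal.log_le_log_iff, ← ofReal_measureReal,
    ENNReal.ofReal_le_ofReal_iff measureReal_nonneg, Real.log_exp]

variable {ι : Type*} {l : Filter ι} {v : ι → ℝ}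

theorem eventually_const_mul_exp_le (hv : Tendsto v l atTop) (K : ℝ) {a b : ℝ} (hab : a < b) :
    ∀ᶠ i in l, K * Real.exp (a * v i) ≤ Real.exp (b * v i) := by
  have hgap : Tendsto (fun i => Real.exp ((b - a) * v i)) l atTop :=
    Real.tendsto_exp_atTop.comp (hv.const_mul_atTop (sub_pos.2 hab))
  filter_upwards [hgap.eventually_ge_atTop K] with i hi
  calc K * Real.exp (a * v i) ≤ Real.exp ((b - a) * v i) * Real.exp (a * v i) := by gcongr
    _ = Real.exp (b * v i) := by rw [← Real.exp_add]; ring_nf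

theorem eventually_add_le_exp (hv : Tendsto v l atTop) {q r : ι → ℝ} {a b : ℝ} (hab : a < b)
    (hq : ∀ᶠ i in l, q i ≤ Real.exp (a * v i)) (hr : ∀ᶠ i in l, r i ≤ Real.exp (a * v i)) :
    ∀ᶠ i in l, q i + r i ≤ Real.exp (b * v i) := by
  filter_upwards [hq, hr, eventually_const_mul_exp_le hv 2 hab] with i hqi hri hi
  linarith

variable {Ω : Type*} [MeasurableSpace Ω] {P : Measure Ω}

theorem neg_iInf_interior_le_liminf_log_measure_div [IsFiniteMeasure P] {S : Type*}
    [PseudoMetricSpace S] {Z : ι → Ω → S} {I : S → EReal} (hv : Tendsto v l atTop)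
    (hball : ∀ x, ∀ ε > 0, ∀ c : ℝ, I x < c →
      ∀ᶠ i in l, Real.exp (-c * v i) ≤ P.real {ω | dist (Z i ω) x < ε}) (B : Set S) :
    -(⨅ z ∈ interior B, I z) ≤
      liminf (fun i => ENNReal.log (P {ω | Z i ω ∈ B}) / ((v i : ℝ) : EReal)) l := by
  rw [EReal.neg_le]
  refine le_iInf₂ fun x hx => ?_
  rw [EReal.neg_le, ← EReal.ge_of_forall_gt_iff_ge]
  intro c hc
  have hIx : I x < ((-c : ℝ) : EReal) := EReal.coe_neg c ▸ EReal.lt_neg_comm.1 hc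
  obtain ⟨ε, hε, hεB⟩ := Metric.isOpen_iff.1 isOpen_interior x hx
  refine le_liminf_of_le (by isBoundedDefault) ?_
  filter_upwards [hball x ε hε (-c) hIx, hv.eventually_gt_atTop 0] with i hi hvi
  rw [neg_neg] at hi
  exact (coe_le_log_measure_div_iff hvi).2 <|
    hi.trans (measureReal_mono fun ω hω => interior_subset (s := B) (hεB hω))

theorem eventually_measureReal_mem_inter_Ici_le [IsFiniteMeasure P] {S : Type*}
    [ConditionallyCompleteLinearOrder S] [TopologicalSpace S] [OrderTopology S]
    {Z : ι → Ω → S} {I : S → EReal} {F : Set S} {m : S} {c : ℝ} (hF : IsClosed F) (hm : m ∉ F)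
    (hc : (c : EReal) < ⨅ z ∈ F, I z)
    (htail : ∀ b > m, (c : EReal) < I b →
      ∀ᶠ i in l, P.real {ω | b ≤ Z i ω} ≤ Real.exp (-c * v i)) :
    ∀ᶠ i in l, P.real {ω | Z i ω ∈ F ∩ Set.Ici m} ≤ Real.exp (-c * v i) := by
  rcases (F ∩ Set.Ici m).eq_empty_or_nonempty with hempty | hne
  · simp [hempty, Real.exp_nonneg]
  have hbdd : BddBelow (F ∩ Set.Ici m) := ⟨m, fun x hx => hx.2⟩
  have hmin := (hF.inter isClosed_Ici).csInf_mem hne hbdd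
  have hgt : m < sInf (F ∩ Set.Ici m) := lt_of_le_of_ne hmin.2 fun h => hm (h ▸ hmin.1)
  filter_upwards [htail _ hgt (hc.trans_le (biInf_le I hmin.1))] with i hi
  exact (measureReal_mono fun ω (hω : Z i ω ∈ F ∩ Set.Ici m) => csInf_le hbdd hω).trans hi

theorem limsup_log_measure_div_le_neg_iInf_closure [IsProbabilityMeasure P] {S : Type*}
    [ConditionallyCompleteLinearOrder S] [TopologicalSpace S] [OrderTopology S]
    {Z : ι → Ω → S} {I : S → EReal} {m : S} (hv : Tendsto v l atTop) (hm : I m = 0)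
    (hright : ∀ b > m, ∀ c : ℝ, 0 ≤ c → (c : EReal) < I b →
      ∀ᶠ i in l, P.real {ω | b ≤ Z i ω} ≤ Real.exp (-c * v i))
    (hleft : ∀ a < m, ∀ c : ℝ, 0 ≤ c → (c : EReal) < I a →
      ∀ᶠ i in l, P.real {ω | Z i ω ≤ a} ≤ Real.exp (-c * v i)) (B : Set S) :
    limsup (fun i => ENNReal.log (P {ω | Z i ω ∈ B}) / ((v i : ℝ) : EReal)) l ≤
      -(⨅ z ∈ closure B, I z) := by
  rw [← EReal.le_of_forall_lt_iff_le]
  intro z hz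
  refine limsup_le_of_le (by isBoundedDefault) ?_
  suffices h : ∀ᶠ i in l, P.real {ω | Z i ω ∈ B} ≤ Real.exp (z * v i) by
    filter_upwards [h, hv.eventually_gt_atTop 0] with i hi hvi
    exact (log_measure_div_le_coe_iff hvi).2 hi
  rcases lt_or_ge 0 z with hz0 | hz0
  · filter_upwards [hv.eventually_gt_atTop 0] with i hvi
    exact measureReal_le_one.trans (Real.one_le_exp (by positivity))
  obtain ⟨c, hzc, hc⟩ := EReal.lt_iff_exists_real_btwn.1 (EReal.neg_lt_comm.1 hz)
  have hzc : -z < c := by exact_mod_cast hzc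
  have hc0 : 0 ≤ c := by linarith
  have hmB : m ∉ closure B := fun h => by
    have := hc.trans_le (biInf_le I h)
    exact this.not_ge (hm ▸ EReal.coe_nonneg.2 hc0)
  have hR := eventually_measureReal_mem_inter_Ici_le (P := P) isClosed_closure hmB hc
    fun b hb hcb => hright b hb c hc0 hcb
  have hL := eventually_measureReal_mem_inter_Ici_le (P := P) (S := Sᵒᵈ) isClosed_closure hmB hc
    fun a ha hca => hleft a ha c hc0 hca
  filter_upwards [eventually_add_le_exp hv (by linarith : -c < z) hR hL] with i hi
  refine (measureReal_mono fun ω hω => ?_).trans ((measureReal_union_le _ _).trans hi)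
  exact (le_total m (Z i ω)).imp (fun h => ⟨subset_closure hω, h⟩) fun h => ⟨subset_closure hω, h⟩

theorem SatisfiesLDP.of_halfLines [IsProbabilityMeasure P] {Z : ℕ → Ω → ℝ} {v : ℕ → ℝ}
    {I : ℝ → EReal} {m : ℝ} (hv : Tendsto v atTop atTop) (hnonneg : ∀ x, 0 ≤ I x)
    (hlsc : LowerSemicontinuous I) (hm : I m = 0)
    (hright : ∀ b > m, ∀ c : ℝ, 0 ≤ c → (c : EReal) < I b →
      ∀ᶠ n in atTop, P.real {ω | b ≤ Z n ω} ≤ Real.exp (-c * v n))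
    (hleft : ∀ a < m, ∀ c : ℝ, 0 ≤ c → (c : EReal) < I a →
      ∀ᶠ n in atTop, P.real {ω | Z n ω ≤ a} ≤ Real.exp (-c * v n))
    (hball : ∀ x, ∀ ε > 0, ∀ c : ℝ, I x < c →
      ∀ᶠ n in atTop, Real.exp (-c * v n) ≤ P.real {ω | |Z n ω - x| < ε}) :
    SatisfiesLDP P Z v I :=
  ⟨hnonneg, hlsc, fun B _ => ⟨neg_iInf_interior_le_liminf_log_measure_div hv hball B,
    limsup_log_measure_div_le_neg_iInf_closure hv hm hright hleft B⟩⟩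

end LargeDeviations

section EmpiricalMean

variable {Ω : Type*} (X : ℕ → Ω → ℝ) (n : ℕ) (ω : Ω)

theorem natCast_mul_empiricalMean :
    n * empiricalMean X n ω = (∑ i ∈ Finset.range n, X i) ω := by
  rcases n.eq_zero_or_pos with rfl | hn
  · simp
  · rw [empiricalMean, Finset.sum_apply]
    field_simp

theorem empiricalMean_neg :
    empiricalMean (-X) n ω = -empiricalMean X n ω := by
  simp [empiricalMean]

end EmpiricalMean

section IdentDistrib

variable {Ω Ω' : Type*} [MeasurableSpace Ω] [MeasurableSpace Ω'] {P : Measure Ω} {Q : Measure Ω'}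
  {X : ℕ → Ω → ℝ} {W : Ω' → ℝ}

theorem cgf_sum_range (hindep : iIndepFun X P) (hid : ∀ i, IdentDistrib (X i) W P Q) (n : ℕ) :
    cgf (∑ i ∈ Finset.range n, X i) P = fun t => n * cgf W Q t := by
  ext t
  rw [cgf, hindep.mgf_sum₀ fun i => (hid i).aemeasurable_fst]
  simp [fun i => congrFun (mgf_congr_identDistrib (hid i)) t, Real.log_pow, cgf]

theorem integrableExpSet_subset_sum_range [NeZero Q] (hindep : iIndepFun X P)
    (hid : ∀ i, IdentDistrib (X i) W P Q) (n : ℕ) :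
    integrableExpSet W Q ⊆ integrableExpSet (∑ i ∈ Finset.range n, X i) P := by
  intro t ht
  have := hindep.isProbabilityMeasure
  refine mgf_pos_iff.1 ?_
  rw [hindep.mgf_sum₀ fun i => (hid i).aemeasurable_fst]
  refine Finset.prod_pos fun i _ => ?_
  rw [mgf_congr_identDistrib (hid i)]
  exact mgf_pos_iff.2 ht

theorem measureReal_le_empiricalMean_le [NeZero Q] (hindep : iIndepFun X P)
    (hid : ∀ i, IdentDistrib (X i) W P Q) {t : ℝ} (ht0 : 0 ≤ t)
    (ht : t ∈ integrableExpSet W Q) (b : ℝ) (n : ℕ) :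
    P.real {ω | b ≤ empiricalMean X n ω} ≤ Real.exp (-(t * b - cgf W Q t) * n) := by
  have := hindep.isProbabilityMeasure
  calc P.real {ω | b ≤ empiricalMean X n ω}
      ≤ P.real {ω | n * b ≤ (∑ i ∈ Finset.range n, X i) ω} := by
        refine measureReal_mono fun ω (hω : b ≤ _) => ?_
        rw [Set.mem_ofPred_eq, ← natCast_mul_empiricalMean]
        gcongr
    _ ≤ Real.exp (-t * (n * b) + cgf (∑ i ∈ Finset.range n, X i) P t) :=
        measure_ge_le_exp_cgf _ ht0 (integrableExpSet_subset_sum_range hindep hid n ht)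
    _ = Real.exp (-(t * b - cgf W Q t) * n) := by rw [cgf_sum_range hindep hid]; ring_nf

end IdentDistrib

section Cramer

variable {Ω Ω' : Type*} [MeasurableSpace Ω] [MeasurableSpace Ω'] {P : Measure Ω} {Q : Measure Ω'}
  {X : ℕ → Ω → ℝ} {W : Ω' → ℝ}

theorem one_sub_variance_div_sq_le_measureReal [IsProbabilityMeasure Q] (hW : MemLp W 2 Q) {r : ℝ}
    (hr : 0 < r) : 1 - Var[W; Q] / r ^ 2 ≤ Q.real {ω | |W ω - Q[W]| < r} := by
  have hnull : NullMeasurableSet {ω | r ≤ |W ω - Q[W]|} Q :=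
    nullMeasurableSet_le aemeasurable_const (hW.aemeasurable.sub_const _).norm
  have hcheb : Q.real {ω | r ≤ |W ω - Q[W]|} ≤ Var[W; Q] / r ^ 2 :=
    ENNReal.toReal_le_of_le_ofReal (div_nonneg (variance_nonneg W Q) (sq_nonneg r))
      (meas_ge_le_variance_div_sq hW hr)
  have hcompl := probReal_compl_eq_one_sub₀ hnull
  simp only [Set.compl_ofPred, not_le] at hcompl
  linarith

/-- Exponential tilting by `t` centres `W` at `deriv (cgf W Q) t`; Chebyshev's inequality for the
tilted law then bounds the mass near that point from below. -/
theorem mul_exp_le_measureReal_abs_sub_deriv_cgf_lt [IsProbabilityMeasure Q] {t r : ℝ}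
    (ht : t ∈ interior (integrableExpSet W Q)) (hr : 0 < r) :
    (1 - iteratedDeriv 2 (cgf W Q) t / r ^ 2) *
        Real.exp (cgf W Q t - t * deriv (cgf W Q) t - |t| * r) ≤
      Q.real {ω | |W ω - deriv (cgf W Q) t| < r} := by
  set x := deriv (cgf W Q) t with hx
  set A := {ω | |W ω - x| < r}
  have hint := interior_subset ht
  have := isProbabilityMeasure_tilted (f := fun ω => t * W ω) hint
  have hcheb : 1 - iteratedDeriv 2 (cgf W Q) t / r ^ 2 ≤ (Q.tilted fun ω => t * W ω).real A := by
    rw [← variance_tilted_mul ht]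
    convert one_sub_variance_div_sq_le_measureReal (memLp_tilted_mul ht 2) hr
    exact hx.trans (integral_tilted_mul_self ht).symm
  have hdensity : ∀ ω ∈ A,
      ‖Real.exp (t * W ω - cgf W Q t)‖ ≤ Real.exp (t * x + |t| * r - cgf W Q t) := by
    intro ω hω
    have : t * (W ω - x) ≤ |t| * r :=
      (le_abs_self _).trans <| by rw [abs_mul]; gcongr; exact le_of_lt hω
    rw [Real.norm_eq_abs, Real.abs_exp]
    gcongr
    linarith
  have htilt : (Q.tilted fun ω => t * W ω).real A ≤
      Real.exp (t * x + |t| * r - cgf W Q t) * Q.real A := by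
    rw [Measure.real, tilted_mul_apply_eq_ofReal_integral_cgf A hint,
      ENNReal.toReal_ofReal (integral_nonneg fun _ => Real.exp_nonneg _)]
    exact (le_abs_self _).trans (norm_setIntegral_le_of_norm_le_const (measure_lt_top _ _) hdensity)
  calc _ ≤ Real.exp (t * x + |t| * r - cgf W Q t) * Q.real A *
          Real.exp (cgf W Q t - t * x - |t| * r) := by gcongr; exact hcheb.trans htilt
    _ = Q.real A := by
        rw [mul_right_comm, ← Real.exp_add]
        ring_nf
        simp

theorem mul_exp_le_measureReal_abs_empiricalMean_sub_deriv_cgf_lt [IsProbabilityMeasure Q]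
    (hindep : iIndepFun X P) (hid : ∀ i, IdentDistrib (X i) W P Q) {t r : ℝ}
    (ht : t ∈ interior (integrableExpSet W Q)) (hr : 0 < r) {n : ℕ} (hn : 0 < n) :
    (1 - iteratedDeriv 2 (cgf W Q) t / r ^ 2 / n) *
        Real.exp ((cgf W Q t - t * deriv (cgf W Q) t - |t| * r) * n) ≤
      P.real {ω | |empiricalMean X n ω - deriv (cgf W Q) t| < r} := by
  have := hindep.isProbabilityMeasure
  have hn0 : (0 : ℝ) < n := Nat.cast_pos.2 hn
  set x := deriv (cgf W Q) t with hx
  set S := ∑ i ∈ Finset.range n, X i with hS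
  have hcgf : cgf S P = fun t => n * cgf W Q t := cgf_sum_range hindep hid n
  have htS : t ∈ interior (integrableExpSet S P) :=
    interior_mono (integrableExpSet_subset_sum_range hindep hid n) ht
  have htilt := mul_exp_le_measureReal_abs_sub_deriv_cgf_lt htS (mul_pos hn0 hr)
  simp only [hcgf, deriv_const_mul_field, iteratedDeriv_const_mul_field, ← hx] at htilt
  calc _ = (1 - n * iteratedDeriv 2 (cgf W Q) t / (n * r) ^ 2) *
          Real.exp (n * cgf W Q t - t * (n * x) - |t| * (n * r)) := by congr 2 <;> field_simp
    _ ≤ P.real {ω | |S ω - n * x| < n * r} := htilt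
    _ = P.real {ω | |empiricalMean X n ω - x| < r} := by
        simp_rw [hS, ← natCast_mul_empiricalMean, ← mul_sub, abs_mul, Nat.abs_cast,
          mul_lt_mul_iff_right₀ hn0]

theorem eventually_exp_le_measureReal_abs_empiricalMean_sub_deriv_cgf_lt
    [IsProbabilityMeasure Q] (hindep : iIndepFun X P) (hid : ∀ i, IdentDistrib (X i) W P Q)
    {t ε c : ℝ} (ht : t ∈ interior (integrableExpSet W Q)) (hε : 0 < ε)
    (hc : t * deriv (cgf W Q) t - cgf W Q t < c) :
    ∀ᶠ n : ℕ in atTop, Real.exp (-c * n) ≤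
      P.real {ω | |empiricalMean X n ω - deriv (cgf W Q) t| < ε} := by
  have := hindep.isProbabilityMeasure
  obtain ⟨r₀, hr₀, hgap⟩ := exists_pos_mul_lt (sub_pos.2 hc) |t|
  obtain ⟨r, hr, hrε, hrr₀⟩ : ∃ r > 0, r ≤ ε ∧ r ≤ r₀ :=
    ⟨min ε r₀, lt_min hε hr₀, min_le_left _ _, min_le_right _ _⟩
  set d := cgf W Q t - t * deriv (cgf W Q) t - |t| * r
  have hcd : -c < d := by
    have : |t| * r ≤ |t| * r₀ := by gcongr
    linarith
  have hvar : ∀ᶠ n : ℕ in atTop, iteratedDeriv 2 (cgf W Q) t / r ^ 2 / n ≤ 1 / 2 :=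
    (tendsto_const_div_atTop_nhds_zero_nat _).eventually_le_const (by norm_num)
  filter_upwards [hvar, eventually_gt_atTop 0,
    eventually_const_mul_exp_le tendsto_natCast_atTop_atTop 2 hcd] with n hvarn hn hexp
  calc Real.exp (-c * n) ≤ (1 / 2) * Real.exp (d * n) := by linarith
    _ ≤ (1 - iteratedDeriv 2 (cgf W Q) t / r ^ 2 / n) * Real.exp (d * n) := by
        gcongr
        linarith
    _ ≤ P.real {ω | |empiricalMean X n ω - deriv (cgf W Q) t| < r} :=
        mul_exp_le_measureReal_abs_empiricalMean_sub_deriv_cgf_lt hindep hid ht hr hn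
    _ ≤ P.real {ω | |empiricalMean X n ω - deriv (cgf W Q) t| < ε} :=
        measureReal_mono fun ω hω => lt_of_lt_of_le hω hrε

theorem mul_integral_le_cgf [IsProbabilityMeasure Q] (hW : Integrable W Q) {t : ℝ}
    (ht : t ∈ integrableExpSet W Q) : t * Q[W] ≤ cgf W Q t := by
  rw [cgf, Real.le_log_iff_exp_le (mgf_pos ht), ← integral_const_mul]
  exact convexOn_exp.map_integral_le Real.continuous_exp.continuousOn isClosed_univ
    (ae_of_all _ fun _ => Set.mem_univ _) (hW.const_mul t) ht

theorem lowerSemicontinuous_legendre (L : ℝ → EReal) : LowerSemicontinuous (legendre L) := by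
  refine lowerSemicontinuous_iSup fun η => Continuous.lowerSemicontinuous ?_
  induction L η with
  | bot =>
    simp only [sub_eq_add_neg, EReal.neg_bot, EReal.coe_add_top]
    exact continuous_const
  | top => simp [continuous_const]
  | coe l =>
    simp_rw [← EReal.coe_sub]
    exact continuous_coe_real_ereal.comp (by fun_prop)

theorem freeEnergy_eq_coe_cgf [NeZero Q] {t : ℝ} (ht : t ∈ integrableExpSet W Q) :
    freeEnergy Q W t = cgf W Q t := by
  rw [freeEnergy, ← ofReal_integral_eq_lintegral_ofReal ht (ae_of_all _ fun _ => Real.exp_nonneg _)]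
  exact ENNReal.log_ofReal_of_pos (mgf_pos_iff.2 ht)

theorem freeEnergy_eq_top (hW : AEMeasurable W Q) {t : ℝ} (ht : t ∉ integrableExpSet W Q) :
    freeEnergy Q W t = ⊤ := by
  have hmeas : AEMeasurable (fun ω => Real.exp (t * W ω)) Q := by fun_prop
  rw [freeEnergy, ENNReal.log_eq_top_iff]
  contrapose! ht
  exact (lintegral_ofReal_ne_top_iff_integrable hmeas.aestronglyMeasurable
    (ae_of_all _ fun _ => Real.exp_nonneg _)).1 ht

theorem freeEnergy_congr_identDistrib {Ω'' : Type*} [MeasurableSpace Ω''] {R : Measure Ω''}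
    {V : Ω'' → ℝ} (h : IdentDistrib W V Q R) : freeEnergy Q W = freeEnergy R V := by
  ext t
  exact congrArg ENNReal.log (h.comp (u := fun x => ENNReal.ofReal (Real.exp (t * x)))
    (by fun_prop)).lintegral_eq

theorem coe_sub_cgf_le_legendre_freeEnergy [NeZero Q] {t x : ℝ} (ht : t ∈ integrableExpSet W Q) :
    ((t * x - cgf W Q t : ℝ) : EReal) ≤ legendre (freeEnergy Q W) x := by
  rw [EReal.coe_sub, ← freeEnergy_eq_coe_cgf ht]
  exact le_iSup (fun η : ℝ => ((η * x : ℝ) : EReal) - freeEnergy Q W η) t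

theorem lt_legendre_freeEnergy_iff [NeZero Q] (hW : AEMeasurable W Q) {c x : ℝ} :
    (c : EReal) < legendre (freeEnergy Q W) x ↔
      ∃ t ∈ integrableExpSet W Q, c < t * x - cgf W Q t := by
  rw [legendre, lt_iSup_iff]
  refine exists_congr fun t => ?_
  by_cases ht : t ∈ integrableExpSet W Q
  · rw [freeEnergy_eq_coe_cgf ht, ← EReal.coe_sub, EReal.coe_lt_coe_iff]
    simp [ht]
  · simp [freeEnergy_eq_top hW ht, ht]

theorem legendre_freeEnergy_nonneg [IsProbabilityMeasure Q] (x : ℝ) :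
    0 ≤ legendre (freeEnergy Q W) x :=
  le_iSup_of_le 0 (by simp [freeEnergy])

theorem legendre_freeEnergy_integral [IsProbabilityMeasure Q] (hW : Integrable W Q) :
    legendre (freeEnergy Q W) Q[W] = 0 := by
  refine le_antisymm (not_lt.1 fun h => ?_) (legendre_freeEnergy_nonneg _)
  obtain ⟨t, ht, hlt⟩ := (lt_legendre_freeEnergy_iff hW.aemeasurable).1 (EReal.coe_zero ▸ h)
  linarith [mul_integral_le_cgf hW ht]

theorem measureReal_le_empiricalMean_le_of_lt_legendre [IsProbabilityMeasure Q]
    (hindep : iIndepFun X P) (hid : ∀ i, IdentDistrib (X i) W P Q) (hW : Integrable W Q)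
    {b c : ℝ} (hb : Q[W] < b) (hc0 : 0 ≤ c) (hc : (c : EReal) < legendre (freeEnergy Q W) b)
    (n : ℕ) : P.real {ω | b ≤ empiricalMean X n ω} ≤ Real.exp (-c * n) := by
  obtain ⟨t, ht, hct⟩ := (lt_legendre_freeEnergy_iff hW.aemeasurable).1 hc
  have ht0 : 0 ≤ t := by
    by_contra! hneg
    nlinarith [mul_integral_le_cgf hW ht]
  refine (measureReal_le_empiricalMean_le hindep hid ht0 ht b n).trans ?_
  gcongr

theorem legendre_freeEnergy_neg (x : ℝ) :
    legendre (freeEnergy Q (-W)) (-x) = legendre (freeEnergy Q W) x :=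
  (Equiv.neg ℝ).iSup_congr fun t => by simp [freeEnergy]

theorem satisfiesLDP_empiricalMean_of_surjOn_deriv_cgf [IsProbabilityMeasure Q]
    (hindep : iIndepFun X P) (hid : ∀ i, IdentDistrib (X i) W P Q) (hW : Integrable W Q)
    (hsteep : Set.SurjOn (deriv (cgf W Q)) (interior (integrableExpSet W Q)) Set.univ) :
    SatisfiesLDP P (empiricalMean X) (fun n => (n : ℝ)) (legendre (freeEnergy Q W)) := by
  have := hindep.isProbabilityMeasure
  refine SatisfiesLDP.of_halfLines tendsto_natCast_atTop_atTop legendre_freeEnergy_nonneg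
    (lowerSemicontinuous_legendre _) (legendre_freeEnergy_integral hW) ?_ ?_ ?_
  · intro b hb c hc0 hc
    exact .of_forall (measureReal_le_empiricalMean_le_of_lt_legendre hindep hid hW hb hc0 hc)
  · intro a ha c hc0 hc
    have hneg := measureReal_le_empiricalMean_le_of_lt_legendre (X := -X) (W := -W) (b := -a)
      (hindep.comp (fun _ x => -x) fun _ => measurable_neg)
      (fun i => (hid i).comp measurable_neg) hW.neg
      (by simpa [integral_neg] using ha) hc0 (by rwa [legendre_freeEnergy_neg])
    simp only [empiricalMean_neg, neg_le_neg_iff] at hneg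
    exact .of_forall hneg
  · intro x ε hε c hc
    obtain ⟨t, ht, rfl⟩ := hsteep (Set.mem_univ x)
    refine eventually_exp_le_measureReal_abs_empiricalMean_sub_deriv_cgf_lt hindep hid ht hε ?_
    exact EReal.coe_lt_coe_iff.1 <|
      (coe_sub_cgf_le_legendre_freeEnergy (interior_subset ht)).trans_lt hc

end Cramer

section Steep

variable {Ω : Type*} [MeasurableSpace Ω] {Q : Measure Ω} {W : Ω → ℝ}

theorem exists_deriv_cgf_eq [IsProbabilityMeasure Q] {a b x : ℝ} (ha : a ≤ 0) (hb : 0 ≤ b)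
    (hsub : Set.Icc a b ⊆ interior (integrableExpSet W Q))
    (hax : a * x < cgf W Q a) (hbx : b * x < cgf W Q b) :
    ∃ t ∈ interior (integrableExpSet W Q), deriv (cgf W Q) t = x := by
  have hcont : ContinuousOn (fun t => t * x - cgf W Q t) (Set.Icc a b) :=
    (continuousOn_id.mul continuousOn_const).sub (analyticOnNhd_cgf.continuousOn.mono hsub)
  have h0 : (0 : ℝ) ∈ Set.Icc a b := ⟨ha, hb⟩
  obtain ⟨t, ht, hmax⟩ := isCompact_Icc.exists_isMaxOn ⟨0, h0⟩ hcont
  have hnonneg : 0 ≤ t * x - cgf W Q t := by simpa using hmax h0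
  have hta : a ≠ t := fun h => by rw [← h] at hnonneg; linarith
  have htb : t ≠ b := fun h => by rw [h] at hnonneg; linarith
  have hnhds : Set.Icc a b ∈ nhds t :=
    Icc_mem_nhds (lt_of_le_of_ne ht.1 hta) (lt_of_le_of_ne ht.2 htb)
  have hderiv : HasDerivAt (fun t => t * x - cgf W Q t) (1 * x - deriv (cgf W Q) t) t :=
    ((hasDerivAt_id t).mul_const x).sub
      (analyticAt_cgf (hsub ht)).differentiableAt.hasDerivAt
  refine ⟨t, hsub ht, ?_⟩
  linarith [(hmax.isLocalMax hnhds).hasDerivAt_eq_zero hderiv]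

theorem surjOn_deriv_cgf_of_identDistrib_neg [IsProbabilityMeasure Q]
    (hsymm : IdentDistrib W (-W) Q Q)
    (hsteep : ∀ x, ∃ a ≥ 0, Set.Icc (-a) a ⊆ interior (integrableExpSet W Q) ∧
      a * x < cgf W Q a) :
    Set.SurjOn (deriv (cgf W Q)) (interior (integrableExpSet W Q)) Set.univ := by
  intro x _
  obtain ⟨a, ha, hsub, hax⟩ := hsteep |x|
  have hcgf : cgf W Q (-a) = cgf W Q a := by
    rw [← cgf_neg, cgf, cgf, mgf_congr_identDistrib hsymm]
  refine exists_deriv_cgf_eq (neg_nonpos.2 ha) ha hsub ?_ ?_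
  · calc -a * x = a * -x := by ring
      _ ≤ a * |x| := by gcongr; exact neg_le_abs x
      _ < cgf W Q (-a) := hcgf ▸ hax
  · calc a * x ≤ a * |x| := by gcongr; exact le_abs_self x
      _ < cgf W Q a := hax

theorem exists_mul_lt_cgf_of_unbounded [IsFiniteMeasure Q]
    (hint : ∀ t, t ∈ integrableExpSet W Q) (hunbdd : ∀ R, 0 < Q.real {ω | R ≤ W ω}) (x : ℝ) :
    ∃ a ≥ 0, a * x < cgf W Q a := by
  set q := Q.real {ω | x + 1 ≤ W ω}
  have ha : 0 ≤ |Real.log q| + 1 := by positivity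
  refine ⟨|Real.log q| + 1, ha, ?_⟩
  have hchernoff := Real.log_le_log (hunbdd _) (measure_ge_le_exp_cgf (x + 1) ha (hint _))
  rw [Real.log_exp] at hchernoff
  linarith [neg_abs_le (Real.log q)]

theorem surjOn_deriv_cgf_of_unbounded [IsProbabilityMeasure Q]
    (hsymm : IdentDistrib W (-W) Q Q) (hint : ∀ t, t ∈ integrableExpSet W Q)
    (hunbdd : ∀ R, 0 < Q.real {ω | R ≤ W ω}) :
    Set.SurjOn (deriv (cgf W Q)) (interior (integrableExpSet W Q)) Set.univ := by
  refine surjOn_deriv_cgf_of_identDistrib_neg hsymm fun x => ?_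
  obtain ⟨a, ha, hax⟩ := exists_mul_lt_cgf_of_unbounded hint hunbdd x
  exact ⟨a, ha, by simp [Set.eq_univ_of_forall hint], hax⟩

end Steep

section TruncatedTail

variable {Ω Ω' : Type*} [MeasurableSpace Ω] [MeasurableSpace Ω'] {P : Measure Ω} {Q : Measure Ω'}
  {X : ℕ → Ω → ℝ} {W : Ω' → ℝ} {α θ T : ℝ}

theorem exp_le_one_add_add_sq_mul_exp {u w : ℝ} (huw : u ≤ w) (hw : 0 ≤ w) :
    Real.exp u ≤ 1 + u + u ^ 2 * Real.exp w := by
  have hsq : u ^ 2 ≤ u ^ 2 * Real.exp w :=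
    le_mul_of_one_le_right (sq_nonneg u) (Real.one_le_exp hw)
  rcases le_total 0 u with hu | hu
  · have hfirst : Real.exp u ≤ 1 + u * Real.exp u := by
      have := mul_le_mul_of_nonneg_right (Real.one_sub_le_exp_neg u) (Real.exp_nonneg u)
      rw [← Real.exp_add, neg_add_cancel, Real.exp_zero] at this
      linarith
    calc Real.exp u ≤ 1 + u * (1 + u * Real.exp u) := by nlinarith
      _ ≤ 1 + u * (1 + u * Real.exp w) := by gcongr
      _ = 1 + u + u ^ 2 * Real.exp w := by ring
  · rcases le_total (-1) u with hu1 | hu1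
    · have := Real.abs_exp_sub_one_sub_id_le (abs_le.2 ⟨hu1, by linarith⟩)
      linarith [le_abs_self (Real.exp u - 1 - u)]
    · nlinarith [Real.exp_le_one_iff.2 hu]

theorem rpow_sub_one_mul_min_le (hα0 : 0 ≤ α) (hα1 : α ≤ 1) (hT : 0 < T) (w : ℝ) :
    T ^ (α - 1) * min w T ≤ |w| ^ α := by
  rcases le_total w 0 with hw | hw
  · exact (mul_nonpos_of_nonneg_of_nonpos (by positivity) ((min_le_left w T).trans hw)).trans
      (by positivity)
  rw [abs_of_nonneg hw]
  rcases hw.eq_or_lt with rfl | hw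
  · rw [min_eq_left hT.le, mul_zero]
    positivity
  calc T ^ (α - 1) * min w T ≤ min w T ^ (α - 1) * min w T := by
        gcongr ?_ * _
        exact Real.rpow_le_rpow_of_nonpos (lt_min hw hT) (min_le_right w T) (by linarith)
    _ = min w T ^ α := by
        rw [Real.rpow_sub_one (lt_min hw hT).ne', div_mul_cancel₀ _ (lt_min hw hT).ne']
    _ ≤ w ^ α := by gcongr; exact min_le_left w T

theorem integrable_sq_mul_exp_rpow_abs {θ' : ℝ} (hα : 0 < α) (hθ : 0 ≤ θ)
    (hθ' : θ < θ') (hW : AEMeasurable W Q)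
    (hexp : Integrable (fun ω => Real.exp (θ' * |W ω| ^ α)) Q) :
    Integrable (fun ω => W ω ^ 2 * Real.exp (θ * |W ω| ^ α)) Q := by
  have hneg : Integrable (fun ω => Real.exp (-θ' * |W ω| ^ α)) Q := by
    refine hexp.mono' (((hW.norm.pow_const α).const_mul _).exp.aestronglyMeasurable)
      (ae_of_all _ fun ω => ?_)
    rw [Real.norm_eq_abs, Real.abs_exp]
    gcongr
    linarith
  have := integrable_rpow_abs_mul_exp_add_of_integrable_exp_mul (v := 0) (t := θ') (x := θ)
    (X := fun ω => |W ω| ^ α) (p := 2 / α) (by simpa using hexp) (by simpa using hneg) hθ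
    (hθ'.trans_le (le_abs_self _)) (by positivity)
  refine this.congr (ae_of_all _ fun ω => ?_)
  beta_reduce
  rw [zero_mul, zero_add, abs_of_nonneg (by positivity), ← Real.rpow_mul (abs_nonneg _),
    mul_div_cancel₀ _ hα.ne', Real.rpow_two, sq_abs]

theorem memLp_two_of_integrable_exp_rpow_abs (hα : 0 < α) (hθ : 0 < θ)
    (hW : AEMeasurable W Q) (hexp : Integrable (fun ω => Real.exp (θ * |W ω| ^ α)) Q) :
    MemLp W 2 Q :=
  (memLp_two_iff_integrable_sq hW.aestronglyMeasurable).2 <| by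
    simpa using integrable_sq_mul_exp_rpow_abs hα le_rfl hθ hW hexp

theorem exp_mul_rpow_sub_one_mul_min_le (hα0 : 0 ≤ α) (hα1 : α ≤ 1) (hθ : 0 ≤ θ)
    (hT : 0 < T) (w : ℝ) : Real.exp (θ * T ^ (α - 1) * min w T) ≤ 1 + θ * T ^ (α - 1) * w +
      (θ * T ^ (α - 1)) ^ 2 * (w ^ 2 * Real.exp (θ * |w| ^ α)) := by
  have hle : θ * T ^ (α - 1) * min w T ≤ θ * |w| ^ α := by
    rw [mul_assoc]
    gcongr
    exact rpow_sub_one_mul_min_le hα0 hα1 hT w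
  have hminsq : min w T ^ 2 ≤ w ^ 2 := by
    rcases min_cases w T with h | h <;> rw [h.1]
    nlinarith
  refine (exp_le_one_add_add_sq_mul_exp hle (by positivity)).trans ?_
  rw [mul_pow, mul_assoc (_ ^ 2)]
  gcongr
  exact min_le_left w T

theorem cgf_min_le [IsProbabilityMeasure Q] (hα0 : 0 ≤ α) (hα1 : α ≤ 1) (hθ : 0 ≤ θ)
    (hT : 0 < T) (hW : Integrable W Q)
    (hsq : Integrable (fun ω => W ω ^ 2 * Real.exp (θ * |W ω| ^ α)) Q) :
    cgf (fun ω => min (W ω) T) Q (θ * T ^ (α - 1)) ≤ θ * T ^ (α - 1) * Q[W] +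
      (θ * T ^ (α - 1)) ^ 2 * ∫ ω, W ω ^ 2 * Real.exp (θ * |W ω| ^ α) ∂Q := by
  set s := θ * T ^ (α - 1)
  have hs0 : 0 ≤ s := by positivity
  have hlin : Integrable (fun ω => 1 + s * W ω) Q := (integrable_const _).add (hW.const_mul s)
  have hmgf : mgf (fun ω => min (W ω) T) Q s ≤
      1 + (s * Q[W] + s ^ 2 * ∫ ω, W ω ^ 2 * Real.exp (θ * |W ω| ^ α) ∂Q) := by
    refine (integral_mono_of_nonneg (ae_of_all _ fun ω => Real.exp_nonneg _)
      (hlin.add (hsq.const_mul (s ^ 2)))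
      (ae_of_all _ fun ω => exp_mul_rpow_sub_one_mul_min_le hα0 hα1 hθ hT (W ω))).trans_eq ?_
    rw [integral_add' hlin (hsq.const_mul _), integral_add (integrable_const _) (hW.const_mul s),
      integral_const_mul, integral_const_mul, integral_const, probReal_univ, one_smul, add_assoc]
  have hpos : 0 < mgf (fun ω => min (W ω) T) Q s :=
    mgf_pos (integrable_exp_mul_of_le s T hs0 (hW.aemeasurable.min aemeasurable_const)
      (ae_of_all _ fun ω => min_le_right _ _))
  rw [cgf]
  linarith [Real.log_le_sub_one_of_pos hpos]

/-- The Chernoff parameter `θ T ^ (α - 1)` is the largest one, up to the factor `θ`, for which the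
exponential moment of the truncation at `T` is controlled by that of `|W| ^ α`. -/
theorem measureReal_le_empiricalMean_min_le [IsProbabilityMeasure Q] (hindep : iIndepFun X P)
    (hid : ∀ i, IdentDistrib (X i) W P Q) (hα0 : 0 ≤ α) (hα1 : α ≤ 1) (hθ : 0 ≤ θ) (hT : 0 < T)
    (hW : Integrable W Q) (hmean : Q[W] = 0)
    (hsq : Integrable (fun ω => W ω ^ 2 * Real.exp (θ * |W ω| ^ α)) Q) (b : ℝ) (n : ℕ) :
    P.real {ω | b ≤ empiricalMean (fun i ω => min (X i ω) T) n ω} ≤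
      Real.exp (-(b - θ * T ^ (α - 1) * ∫ ω, W ω ^ 2 * Real.exp (θ * |W ω| ^ α) ∂Q) *
        (θ * T ^ (α - 1) * n)) := by
  have hmin : Measurable fun x : ℝ => min x T := measurable_id.min measurable_const
  refine (measureReal_le_empiricalMean_le (hindep.comp (fun _ => (min · T)) fun _ => hmin)
    (fun i => (hid i).comp hmin) (t := θ * T ^ (α - 1)) (by positivity)
    (integrable_exp_mul_of_le _ T (by positivity) (hmin.comp_aemeasurable hW.aemeasurable)
      (ae_of_all _ fun ω => min_le_right _ _)) b n).trans (Real.exp_le_exp.2 ?_)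
  have hcgf := mul_le_mul_of_nonneg_right (cgf_min_le hα0 hα1 hθ hT hW hsq) n.cast_nonneg
  rw [hmean] at hcgf
  simp only [Function.comp_def]
  linarith

theorem eventually_measureReal_le_empiricalMean_min_le [IsProbabilityMeasure Q]
    (hindep : iIndepFun X P) (hid : ∀ i, IdentDistrib (X i) W P Q) (hα0 : 0 ≤ α) (hα1 : α < 1)
    (hθ : 0 ≤ θ) (hW : Integrable W Q) (hmean : Q[W] = 0)
    (hsq : Integrable (fun ω => W ω ^ 2 * Real.exp (θ * |W ω| ^ α)) Q) {b c : ℝ} (hb : 0 < b)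
    (hc : c < θ * b ^ α) :
    ∀ᶠ n : ℕ in atTop, P.real {ω | b ≤ empiricalMean (fun i ω => min (X i ω) (n * b)) n ω} ≤
      Real.exp (-c * n ^ α) := by
  set M := ∫ ω, W ω ^ 2 * Real.exp (θ * |W ω| ^ α) ∂Q
  have hparam : Tendsto (fun n : ℕ => θ * (n * b) ^ (α - 1)) atTop (nhds 0) := by
    have := (tendsto_rpow_neg_atTop (sub_pos.2 hα1)).comp
      (tendsto_natCast_atTop_atTop.atTop_mul_const hb)
    simpa [Function.comp_def] using this.const_mul θ
  have hrate : Tendsto (fun n : ℕ => (b - θ * (n * b) ^ (α - 1) * M) * (θ * b ^ (α - 1))) atTop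
      (nhds (θ * b ^ α)) := by
    convert ((hparam.mul_const M).const_sub b).mul_const (θ * b ^ (α - 1)) using 2
    rw [Real.rpow_sub_one hb.ne']
    field_simp
    ring
  filter_upwards [hrate.eventually_const_le hc, eventually_gt_atTop 0] with n hn hn0
  have hn0 : (0 : ℝ) < n := Nat.cast_pos.2 hn0
  refine (measureReal_le_empiricalMean_min_le hindep hid hα0 hα1.le hθ (by positivity) hW hmean
    hsq b n).trans (Real.exp_le_exp.2 ?_)
  have hscale : θ * (n * b) ^ (α - 1) * n = θ * b ^ (α - 1) * (n : ℝ) ^ α := by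
    rw [Real.mul_rpow hn0.le hb.le, Real.rpow_sub_one hn0.ne']
    field_simp
  rw [hscale, neg_mul, neg_mul, neg_le_neg_iff, ← mul_assoc]
  gcongr

end TruncatedTail

section BigJump

variable {Ω Ω' : Type*} [MeasurableSpace Ω] [MeasurableSpace Ω'] {P : Measure Ω} {Q : Measure Ω'}
  {X : ℕ → Ω → ℝ} {W : Ω' → ℝ} {α κ θ : ℝ}

theorem measureReal_lt_le_mul_exp_neg_rpow [IsFiniteMeasure Q] (hα : 0 ≤ α) (hθ : 0 ≤ θ)
    (hexp : Integrable (fun ω => Real.exp (θ * |W ω| ^ α)) Q) {T : ℝ} (hT : 0 ≤ T) :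
    Q.real {ω | T < W ω} ≤ (∫ ω, Real.exp (θ * |W ω| ^ α) ∂Q) * Real.exp (-θ * T ^ α) := by
  rw [mul_comm]
  refine (measureReal_mono fun ω (hω : T < W ω) => ?_).trans
    (measure_ge_le_exp_mul_mgf (X := fun ω => |W ω| ^ α) (T ^ α) hθ hexp)
  exact Real.rpow_le_rpow hT (hω.le.trans (le_abs_self _)) hα

theorem measureReal_exists_lt_le (hid : ∀ i, IdentDistrib (X i) W P Q) (T : ℝ)
    (n : ℕ) : P.real {ω | ∃ i ∈ Finset.range n, T < X i ω} ≤ n * Q.real {ω | T < W ω} := by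
  have hunion : {ω | ∃ i ∈ Finset.range n, T < X i ω} =
      ⋃ i ∈ Finset.range n, {ω | T < X i ω} := by ext; simp
  have hsame : ∀ i, P.real {ω | T < X i ω} = Q.real {ω | T < W ω} := fun i =>
    congrArg ENNReal.toReal ((hid i).measure_mem_eq measurableSet_Ioi)
  rw [hunion]
  refine (measureReal_biUnion_finset_le _ _).trans_eq ?_
  simp [hsame]

theorem eventually_natCast_le_exp_mul_rpow (hα : 0 < α) {δ : ℝ} (hδ : 0 < δ) :
    ∀ᶠ n : ℕ in atTop, (n : ℝ) ≤ Real.exp (δ * n ^ α) := by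
  have hlim := (isLittleO_rpow_exp_pos_mul_atTop (1 / α) hδ).comp_tendsto
    ((tendsto_rpow_atTop hα).comp tendsto_natCast_atTop_atTop)
  filter_upwards [hlim.bound one_pos] with n hn
  simpa [← Real.rpow_mul, hα.ne'] using hn

theorem tendsto_natCast_rpow_atTop (hα : 0 < α) :
    Tendsto (fun n : ℕ => (n : ℝ) ^ α) atTop atTop :=
  (tendsto_rpow_atTop hα).comp tendsto_natCast_atTop_atTop

theorem eventually_measureReal_exists_mul_lt_le [IsFiniteMeasure Q]
    (hid : ∀ i, IdentDistrib (X i) W P Q) (hα : 0 < α) (hθ : 0 ≤ θ)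
    (hexp : Integrable (fun ω => Real.exp (θ * |W ω| ^ α)) Q) {b c : ℝ} (hb : 0 ≤ b)
    (hc : c < θ * b ^ α) :
    ∀ᶠ n : ℕ in atTop, P.real {ω | ∃ i ∈ Finset.range n, n * b < X i ω} ≤
      Real.exp (-c * n ^ α) := by
  set D := ∫ ω, Real.exp (θ * |W ω| ^ α) ∂Q
  obtain ⟨c', hcc', hc'⟩ := exists_between hc
  filter_upwards [eventually_natCast_le_exp_mul_rpow hα (sub_pos.2 hc'),
    eventually_const_mul_exp_le (tendsto_natCast_rpow_atTop hα) D (neg_lt_neg hcc')] with n hn hD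
  calc P.real {ω | ∃ i ∈ Finset.range n, n * b < X i ω}
      ≤ n * (D * Real.exp (-θ * (n * b) ^ α)) :=
        (measureReal_exists_lt_le hid _ n).trans <| by
          gcongr
          exact measureReal_lt_le_mul_exp_neg_rpow hα.le hθ hexp (by positivity)
    _ ≤ Real.exp ((θ * b ^ α - c') * n ^ α) * (D * Real.exp (-θ * (n * b) ^ α)) := by
        gcongr
    _ = D * Real.exp (-c' * n ^ α) := by
        rw [mul_left_comm, ← Real.exp_add, Real.mul_rpow n.cast_nonneg hb]
        ring_nf
    _ ≤ Real.exp (-c * n ^ α) := hD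

theorem eventually_measureReal_le_empiricalMean_le_rpow [IsProbabilityMeasure Q]
    (hindep : iIndepFun X P) (hid : ∀ i, IdentDistrib (X i) W P Q) (hα0 : 0 < α) (hα1 : α < 1)
    (hmean : Q[W] = 0) (hexp : ∀ θ < κ, Integrable (fun ω => Real.exp (θ * |W ω| ^ α)) Q)
    {b c : ℝ} (hb : 0 < b) (hc0 : 0 ≤ c) (hc : c < κ * b ^ α) :
    ∀ᶠ n : ℕ in atTop, P.real {ω | b ≤ empiricalMean X n ω} ≤ Real.exp (-c * n ^ α) := by
  have := hindep.isProbabilityMeasure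
  have hW : AEMeasurable W Q := (hid 0).aemeasurable_snd
  have hbα : 0 < b ^ α := by positivity
  obtain ⟨c', hcc', hc'⟩ := exists_between hc
  obtain ⟨θ, hθ, hθκ⟩ := exists_between ((div_lt_iff₀ hbα).2 hc')
  obtain ⟨θ', hθθ', hθ'κ⟩ := exists_between hθκ
  have hθ0 : 0 < θ := (div_pos (hc0.trans_lt hcc') hbα).trans hθ
  rw [div_lt_iff₀ hbα] at hθ
  have hL2 := memLp_two_of_integrable_exp_rpow_abs hα0 hθ0 hW (hexp θ hθκ)
  have hsq := integrable_sq_mul_exp_rpow_abs hα0 hθ0.le hθθ' hW (hexp θ' hθ'κ)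
  filter_upwards [eventually_add_le_exp (tendsto_natCast_rpow_atTop hα0) (neg_lt_neg hcc')
    (eventually_measureReal_le_empiricalMean_min_le hindep hid hα0.le hα1 hθ0.le
      (hL2.integrable one_le_two) hmean hsq hb hθ)
    (eventually_measureReal_exists_mul_lt_le hid hα0 hθ0.le (hexp θ hθκ) hb.le hθ)] with n hn
  refine (measureReal_mono fun ω hω => ?_).trans ((measureReal_union_le _ _).trans hn)
  by_cases hbig : ∃ i ∈ Finset.range n, n * b < X i ω
  · exact Or.inr hbig
  · push Not at hbig
    refine Or.inl ?_
    have hsum := Finset.sum_congr rfl fun i hi => min_eq_left (hbig i hi)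
    simpa only [Set.mem_ofPred_eq, empiricalMean, hsum] using hω

end BigJump

section SingleJump

variable {Ω Ω' : Type*} [MeasurableSpace Ω] [MeasurableSpace Ω'] {P : Measure Ω} {Q : Measure Ω'}
  {X : ℕ → Ω → ℝ} {W : Ω' → ℝ} {α κ δ : ℝ}

theorem one_sub_le_measureReal_abs_sum_lt (hindep : iIndepFun X P)
    (hid : ∀ i, IdentDistrib (X i) W P Q) (hW : MemLp W 2 Q) (hmean : Q[W] = 0) (hδ : 0 < δ)
    {n : ℕ} (hn : 0 < n) {s : Finset ℕ} (hs : s ⊆ Finset.range n) :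
    1 - Var[W; Q] / δ ^ 2 / n ≤ P.real {ω | |(∑ i ∈ s, X i) ω| < n * δ} := by
  have := hindep.isProbabilityMeasure
  have hn0 : (0 : ℝ) < n := Nat.cast_pos.2 hn
  have hXi : ∀ i, MemLp (X i) 2 P := fun i => (hid i).memLp_iff.2 hW
  have hvar : Var[∑ i ∈ s, X i; P] = s.card * Var[W; Q] := by
    rw [IndepFun.variance_sum (fun i _ => hXi i) fun i _ j _ hij => hindep.indepFun hij,
      Finset.sum_congr rfl fun i _ => (hid i).variance_eq, Finset.sum_const, nsmul_eq_mul]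
  have hzero : P[∑ i ∈ s, X i] = 0 := by
    simp only [Finset.sum_apply]
    rw [integral_finsetSum _ fun i _ => (hXi i).integrable one_le_two]
    exact Finset.sum_eq_zero fun i _ => (hid i).integral_eq.trans hmean
  have hcard : (s.card : ℝ) ≤ n := by
    exact_mod_cast (Finset.card_le_card hs).trans_eq (Finset.card_range n)
  have hcheb := one_sub_variance_div_sq_le_measureReal (memLp_finsetSum' s fun i _ => hXi i)
    (mul_pos hn0 hδ)
  simp only [hzero, sub_zero, hvar] at hcheb
  refine le_trans ?_ hcheb
  have : (s.card : ℝ) * Var[W; Q] / (n * δ) ^ 2 ≤ n * Var[W; Q] / (n * δ) ^ 2 := by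
    gcongr
    exact variance_nonneg W Q
  calc 1 - Var[W; Q] / δ ^ 2 / n = 1 - n * Var[W; Q] / (n * δ) ^ 2 := by field_simp
    _ ≤ _ := by linarith

theorem mul_measureReal_le_measureReal_abs_empiricalMean_sub_lt
    (hindep : iIndepFun X P) (hid : ∀ i, IdentDistrib (X i) W P Q) (hW : MemLp W 2 Q)
    (hmean : Q[W] = 0) (hδ : 0 < δ) (x : ℝ) {n : ℕ} (hn : 0 < n) :
    (1 - Var[W; Q] / δ ^ 2 / n) * Q.real {ω | |W ω - n * x| ≤ n * δ} ≤
      P.real {ω | |empiricalMean X n ω - x| < 2 * δ} := by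
  have := hindep.isProbabilityMeasure
  have hn0 : (0 : ℝ) < n := Nat.cast_pos.2 hn
  set S := ∑ i ∈ (Finset.range n).erase 0, X i
  have hind : IndepFun S (X 0) P :=
    hindep.indepFun_finsetSum_of_notMem₀ (fun i => (hid i).aemeasurable_fst)
      (Finset.notMem_erase 0 _)
  have hjump : MeasurableSet {y : ℝ | |y - n * x| ≤ n * δ} :=
    measurableSet_le (by fun_prop) measurable_const
  have hrest : MeasurableSet {y : ℝ | |y| < n * δ} :=
    measurableSet_lt (by fun_prop) measurable_const
  have hprod : P.real (S ⁻¹' {y | |y| < n * δ} ∩ X 0 ⁻¹' {y | |y - n * x| ≤ n * δ}) =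
      P.real {ω | |S ω| < n * δ} * Q.real {ω | |W ω - n * x| ≤ n * δ} := by
    rw [Measure.real, hind.measure_inter_preimage_eq_mul _ _ hrest hjump, ENNReal.toReal_mul]
    exact congrArg (P.real _ * ·) (congrArg ENNReal.toReal ((hid 0).measure_mem_eq hjump))
  calc _ ≤ P.real {ω | |S ω| < n * δ} * Q.real {ω | |W ω - n * x| ≤ n * δ} := by
        gcongr
        exact one_sub_le_measureReal_abs_sum_lt hindep hid hW hmean hδ hn (Finset.erase_subset _ _)
    _ = _ := hprod.symm
    _ ≤ _ := measureReal_mono ?_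
  rintro ω ⟨hSω : |S ω| < n * δ, hXω : |X 0 ω - n * x| ≤ n * δ⟩
  have hsplit : n * (empiricalMean X n ω - x) = S ω + (X 0 ω - n * x) := by
    rw [mul_sub, natCast_mul_empiricalMean, ← Finset.sum_erase_add _ _ (Finset.mem_range.2 hn)]
    exact add_sub_assoc _ _ _
  refine lt_of_mul_lt_mul_left ?_ hn0.le
  calc n * |empiricalMean X n ω - x| = |S ω + (X 0 ω - n * x)| := by
        rw [← hsplit, abs_mul, abs_of_pos hn0]
    _ ≤ |S ω| + |X 0 ω - n * x| := abs_add_le _ _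
    _ < n * (2 * δ) := by linarith

theorem eventually_exp_le_measureReal_abs_empiricalMean_sub_lt
    (hindep : iIndepFun X P) (hid : ∀ i, IdentDistrib (X i) W P Q) (hα : 0 < α) (hW : MemLp W 2 Q)
    (hmean : Q[W] = 0) (hδ : 0 < δ) {x c c' : ℝ} (hc : c < c')
    (hjump : ∀ᶠ n : ℕ in atTop, Real.exp (-c * n ^ α) ≤ Q.real {ω | |W ω - n * x| ≤ n * δ}) :
    ∀ᶠ n : ℕ in atTop, Real.exp (-c' * n ^ α) ≤
      P.real {ω | |empiricalMean X n ω - x| < 2 * δ} := by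
  have hlln : ∀ᶠ n : ℕ in atTop, 1 / 2 ≤ 1 - Var[W; Q] / δ ^ 2 / n := by
    have := (tendsto_const_div_atTop_nhds_zero_nat (Var[W; Q] / δ ^ 2)).const_sub 1
    exact this.eventually_const_le (by norm_num)
  filter_upwards [hlln, hjump, eventually_gt_atTop 0, eventually_const_mul_exp_le
    (tendsto_natCast_rpow_atTop hα) 2 (neg_lt_neg hc)] with n hn hnjump hn0 hexp
  calc Real.exp (-c' * n ^ α) ≤ 1 / 2 * Real.exp (-c * n ^ α) := by linarith
    _ ≤ (1 - Var[W; Q] / δ ^ 2 / n) * Q.real {ω | |W ω - n * x| ≤ n * δ} := by gcongr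
    _ ≤ _ := mul_measureReal_le_measureReal_abs_empiricalMean_sub_lt hindep hid hW hmean hδ x hn0

theorem satisfiesLDP_empiricalMean_of_stretchedExp [IsProbabilityMeasure Q]
    (hindep : iIndepFun X P) (hid : ∀ i, IdentDistrib (X i) W P Q) (hα0 : 0 < α) (hα1 : α < 1)
    (hκ : 0 < κ) (hmean : Q[W] = 0)
    (hexp : ∀ θ < κ, Integrable (fun ω => Real.exp (θ * |W ω| ^ α)) Q)
    (hjump : ∀ x, ∀ δ > 0, ∀ c > κ * |x| ^ α,
      ∀ᶠ n : ℕ in atTop, Real.exp (-c * n ^ α) ≤ Q.real {ω | |W ω - n * x| ≤ n * δ}) :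
    SatisfiesLDP P (empiricalMean X) (fun n => (n : ℝ) ^ α)
      (fun x => ((κ * |x| ^ α : ℝ) : EReal)) := by
  have := hindep.isProbabilityMeasure
  refine SatisfiesLDP.of_halfLines (m := 0) (tendsto_natCast_rpow_atTop hα0)
    (fun x => EReal.coe_nonneg.2 (by positivity)) ?_ (by simp [hα0.ne']) ?_ ?_ ?_
  · exact (continuous_coe_real_ereal.comp <| continuous_const.mul <|
      continuous_abs.rpow_const fun _ => Or.inr hα0.le).lowerSemicontinuous
  · intro b hb c hc0 hc
    rw [EReal.coe_lt_coe_iff, abs_of_pos hb] at hc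
    exact eventually_measureReal_le_empiricalMean_le_rpow hindep hid hα0 hα1 hmean hexp hb hc0 hc
  · intro a ha c hc0 hc
    rw [EReal.coe_lt_coe_iff, abs_of_neg ha] at hc
    have := eventually_measureReal_le_empiricalMean_le_rpow (X := -X) (W := -W)
      (hindep.comp (fun _ x => -x) fun _ => measurable_neg)
      (fun i => (hid i).comp measurable_neg) hα0 hα1 (by simp [integral_neg, hmean])
      (by simpa using hexp) (neg_pos.2 ha) hc0 hc
    simpa only [empiricalMean_neg, neg_le_neg_iff] using this
  · intro x ε hε c hc
    obtain ⟨c', hc', hcc'⟩ := exists_between (EReal.coe_lt_coe_iff.1 hc)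
    obtain ⟨θ, hθ0, hθκ⟩ := exists_between hκ
    have hW := memLp_two_of_integrable_exp_rpow_abs hα0 hθ0 (hid 0).aemeasurable_snd (hexp θ hθκ)
    simpa only [mul_div_cancel₀ ε two_ne_zero] using
      eventually_exp_le_measureReal_abs_empiricalMean_sub_lt hindep hid hα0 hW hmean
        (half_pos hε) hcc' (hjump x (ε / 2) (half_pos hε) c' hc')

end SingleJump

section SignedPow

variable {p : ℝ}

theorem measurable_signedPow (p : ℝ) : Measurable (signedPow p) := by
  have hsign : Measurable Real.sign :=
    Measurable.ite measurableSet_Iio measurable_const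
      (Measurable.ite measurableSet_Ioi measurable_const measurable_const)
  unfold signedPow
  fun_prop

theorem odd_signedPow (p : ℝ) : (signedPow p).Odd := fun x => by
  simp [signedPow, Real.sign_neg]

theorem signedPow_of_nonneg (hp : 0 < p) {x : ℝ} (hx : 0 ≤ x) : signedPow p x = x ^ p := by
  rcases hx.eq_or_lt with rfl | hx
  · simp [signedPow, Real.zero_rpow hp.ne']
  · simp [signedPow, Real.sign_of_pos hx, abs_of_pos hx]

theorem abs_signedPow (hp : 0 < p) (x : ℝ) : |signedPow p x| = |x| ^ p := by
  wlog hx : 0 ≤ x generalizing x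
  · rw [← abs_neg, ← odd_signedPow, this (-x) (by linarith), abs_neg]
  · rw [signedPow_of_nonneg hp hx, abs_of_nonneg (Real.rpow_nonneg hx p), abs_of_nonneg hx]

theorem abs_signedPow_rpow_one_div (hp : 0 < p) (x : ℝ) : |signedPow p x| ^ (1 / p) = |x| := by
  rw [abs_signedPow hp, one_div, Real.rpow_rpow_inv (abs_nonneg x) hp.ne']

theorem signedPow_one : signedPow 1 = id := by
  ext x
  rcases lt_trichotomy x 0 with h | rfl | h
  · simp [signedPow, Real.sign_of_neg h, abs_of_neg h]
  · simp [signedPow]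
  · simp [signedPow, Real.sign_of_pos h, abs_of_pos h]

end SignedPow

section NegInvariant

variable {G : Type*} [MeasurableSpace G] [InvolutiveNeg G] [MeasurableNeg G] {μ : Measure G}
  [μ.IsNegInvariant]

theorem isNegInvariant_withDensity {f : G → ℝ≥0∞} (hf : Measurable f) (heven : f.Even) :
    (μ.withDensity f).IsNegInvariant := by
  refine ⟨Measure.ext fun s hs => ?_⟩
  rw [Measure.neg_apply, withDensity_apply _ hs.neg, withDensity_apply _ hs,
    ← (Measure.measurePreserving_neg μ).setLIntegral_comp_preimage hs hf]
  simp only [heven _]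
  rfl

theorem identDistrib_neg_of_odd {W : G → ℝ} (hW : AEMeasurable W μ) (hodd : W.Odd) :
    IdentDistrib W (-W) μ μ := by
  refine ⟨hW, hW.neg, ?_⟩
  have hcomp : -W = W ∘ Neg.neg := funext fun y => (hodd y).symm
  rw [hcomp, ← AEMeasurable.map_map_of_aemeasurable (by rwa [Measure.map_neg_eq_self])
    measurable_neg.aemeasurable, Measure.map_neg_eq_self]

end NegInvariant

theorem integral_eq_zero_of_identDistrib_neg {Ω : Type*} [MeasurableSpace Ω] {Q : Measure Ω}
    {W : Ω → ℝ} (hsymm : IdentDistrib W (-W) Q Q) : Q[W] = 0 := by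
  have := hsymm.integral_eq
  simp only [Pi.neg_apply, integral_neg] at this
  linarith

theorem exists_mul_rpow_le_half_add {p : ℝ} (hp0 : 0 ≤ p) (hp1 : p < 1) {a : ℝ} (ha : 0 ≤ a) :
    ∃ C, ∀ x, 0 ≤ x → a * x ^ p ≤ x / 2 + C := by
  set L := 2 * a
  have hL0 : 0 ≤ L := by positivity
  refine ⟨L ^ (1 - p)⁻¹ / 2, fun x hx => ?_⟩
  have hamgm := Real.geom_mean_le_arith_mean2_weighted hp0 (sub_nonneg.2 hp1.le) hx
    (Real.rpow_nonneg hL0 (1 - p)⁻¹) (by ring)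
  rw [Real.rpow_inv_rpow hL0 (by linarith)] at hamgm
  have hx' : p * x ≤ x := mul_le_of_le_one_left hx hp1.le
  have hC : (1 - p) * L ^ (1 - p)⁻¹ ≤ L ^ (1 - p)⁻¹ :=
    mul_le_of_le_one_left (by positivity) (by linarith)
  linarith

namespace twoSidedExponential

variable {p : ℝ}

theorem measurable_density :
    Measurable fun y : ℝ => ENNReal.ofReal (Real.exp (-|y|) / 2) := by
  fun_prop

instance : twoSidedExponential.IsNegInvariant :=
  isNegInvariant_withDensity measurable_density fun y => by rw [abs_neg]

theorem integral_exp_mul_abs {θ : ℝ} (hθ : θ < 1) :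
    ∫ y, Real.exp (θ * |y|) ∂twoSidedExponential = (1 - θ)⁻¹ := by
  rw [twoSidedExponential,
    integral_withDensity_eq_integral_toReal_smul measurable_density (by simp)]
  calc ∫ y, (ENNReal.ofReal (Real.exp (-|y|) / 2)).toReal • Real.exp (θ * |y|)
      = ∫ y, Real.exp ((θ - 1) * |y|) / 2 := by
        refine integral_congr_ae (ae_of_all _ fun y => ?_)
        beta_reduce
        rw [ENNReal.toReal_ofReal (by positivity), smul_eq_mul, div_mul_eq_mul_div,
          ← Real.exp_add]
        ring_nf
    _ = ∫ y in Set.Ioi 0, Real.exp ((θ - 1) * y) := by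
        rw [integral_comp_abs (f := fun y => Real.exp ((θ - 1) * y) / 2), integral_div]
        ring
    _ = (1 - θ)⁻¹ := by
        rw [integral_exp_mul_Ioi (by linarith), mul_zero, Real.exp_zero, ← neg_sub 1 θ,
          neg_div_neg_eq, one_div]

theorem integrable_exp_mul_abs {θ : ℝ} (hθ : θ < 1) :
    Integrable (fun y => Real.exp (θ * |y|)) twoSidedExponential :=
  Integrable.of_integral_ne_zero <| by
    rw [integral_exp_mul_abs hθ]
    exact inv_ne_zero (by linarith)

instance : IsProbabilityMeasure twoSidedExponential := by
  have : twoSidedExponential.real Set.univ = 1 := by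
    simpa using integral_exp_mul_abs (θ := 0) one_pos
  exact ⟨by rw [← ENNReal.toReal_eq_one_iff]; exact this⟩

theorem exp_div_two_le_measureReal_Icc {y : ℝ} (hy : 0 ≤ y) :
    Real.exp (-(y + 1)) / 2 ≤ twoSidedExponential.real (Set.Icc y (y + 1)) := by
  rw [Measure.real, ← ENNReal.ofReal_le_iff_le_toReal (measure_ne_top _ _), twoSidedExponential,
    withDensity_apply _ measurableSet_Icc]
  calc ENNReal.ofReal (Real.exp (-(y + 1)) / 2)
      = ∫⁻ _ in Set.Icc y (y + 1), ENNReal.ofReal (Real.exp (-(y + 1)) / 2) := by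
        simp [Real.volume_Icc]
    _ ≤ _ := by
        refine setLIntegral_mono measurable_density fun z hz => ?_
        gcongr
        rw [abs_of_nonneg (hy.trans hz.1)]
        exact hz.2

theorem identDistrib_signedPow_neg (p : ℝ) :
    IdentDistrib (signedPow p) (-signedPow p) twoSidedExponential twoSidedExponential :=
  identDistrib_neg_of_odd (measurable_signedPow p).aemeasurable (odd_signedPow p)

theorem integrable_exp_mul_abs_signedPow_rpow (hp : 0 < p) {θ : ℝ} (hθ : θ < 1) :
    Integrable (fun y => Real.exp (θ * |signedPow p y| ^ (1 / p))) twoSidedExponential := by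
  simpa only [abs_signedPow_rpow_one_div hp] using integrable_exp_mul_abs hθ

theorem integrable_signedPow (hp : 0 < p) : Integrable (signedPow p) twoSidedExponential :=
  (memLp_two_of_integrable_exp_rpow_abs (one_div_pos.2 hp) one_half_pos
    (measurable_signedPow p).aemeasurable
    (integrable_exp_mul_abs_signedPow_rpow hp one_half_lt_one)).integrable one_le_two

theorem mem_integrableExpSet_signedPow (hp : 0 < p) (hp1 : p < 1) (t : ℝ) :
    t ∈ integrableExpSet (signedPow p) twoSidedExponential := by
  obtain ⟨C, hC⟩ := exists_mul_rpow_le_half_add hp.le hp1 (abs_nonneg t)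
  refine ((integrable_exp_mul_abs one_half_lt_one).const_mul (Real.exp C)).mono'
    ((measurable_signedPow p).const_mul t).exp.aestronglyMeasurable (ae_of_all _ fun y => ?_)
  rw [Real.norm_eq_abs, Real.abs_exp, ← Real.exp_add, Real.exp_le_exp]
  have hle : t * signedPow p y ≤ |t| * |y| ^ p := by
    rw [← abs_signedPow hp, ← abs_mul]
    exact le_abs_self _
  linarith [hC |y| (abs_nonneg y)]

theorem measureReal_le_signedPow_pos (hp : 0 < p) (R : ℝ) :
    0 < twoSidedExponential.real {y | R ≤ signedPow p y} := by
  have hroot : 0 ≤ |R| ^ p⁻¹ := by positivity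
  refine (half_pos (Real.exp_pos _)).trans_le
    ((exp_div_two_le_measureReal_Icc hroot).trans (measureReal_mono fun y hy => ?_))
  calc R ≤ (|R| ^ p⁻¹) ^ p := by
        rw [Real.rpow_inv_rpow (abs_nonneg R) hp.ne']
        exact le_abs_self R
    _ ≤ y ^ p := Real.rpow_le_rpow hroot hy.1 hp.le
    _ = signedPow p y := (signedPow_of_nonneg hp (hroot.trans hy.1)).symm

theorem Ioo_subset_integrableExpSet_id :
    Set.Ioo (-1) 1 ⊆ integrableExpSet id twoSidedExponential := by
  intro t ht
  refine (integrable_exp_mul_abs (abs_lt.2 ht)).mono' (by fun_prop) (ae_of_all _ fun y => ?_)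
  rw [Real.norm_eq_abs, Real.abs_exp, Real.exp_le_exp, ← abs_mul]
  exact le_abs_self _

theorem inv_one_sub_le_two_mul_mgf_id {t : ℝ} (ht0 : 0 ≤ t) (ht1 : t < 1) :
    (1 - t)⁻¹ ≤ 2 * mgf id twoSidedExponential t := by
  have hpos : Integrable (fun y => Real.exp (t * y)) twoSidedExponential :=
    Ioo_subset_integrableExpSet_id ⟨by linarith, ht1⟩
  have hneg : Integrable (fun y => Real.exp (-t * y)) twoSidedExponential :=
    Ioo_subset_integrableExpSet_id ⟨by linarith, by linarith⟩
  have hsymm : ∫ y, Real.exp (-t * y) ∂twoSidedExponential =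
      ∫ y, Real.exp (t * y) ∂twoSidedExponential := by
    rw [← integral_neg_eq_self]
    simp only [neg_mul_neg]
  rw [← integral_exp_mul_abs ht1, two_mul]
  calc ∫ y, Real.exp (t * |y|) ∂twoSidedExponential
      ≤ ∫ y, Real.exp (t * y) + Real.exp (-t * y) ∂twoSidedExponential := by
        refine integral_mono (integrable_exp_mul_abs ht1) (hpos.add hneg) fun y => ?_
        have := Real.exp_pos (t * y)
        have := Real.exp_pos (-t * y)
        rcases abs_choice y with h | h <;> simp only [h, mul_neg, neg_mul] at * <;> linarith
    _ = _ := by rw [integral_add hpos hneg, hsymm]; rfl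

theorem exists_mul_lt_cgf_id (x : ℝ) :
    ∃ a ≥ 0, Set.Icc (-a) a ⊆ interior (integrableExpSet id twoSidedExponential) ∧
      a * x < cgf id twoSidedExponential a := by
  set s := Real.exp (-(|x| + 1)) with hs
  have hs0 : 0 < s := Real.exp_pos _
  have hs1 : s < 1 := Real.exp_lt_one_iff.2 (by linarith [abs_nonneg x])
  refine ⟨1 - s / 2, by linarith, (Set.Icc_subset_Ioo (by linarith) (by linarith)).trans
    (interior_maximal Ioo_subset_integrableExpSet_id isOpen_Ioo), ?_⟩
  have hmgf : Real.exp (|x| + 1) ≤ mgf id twoSidedExponential (1 - s / 2) := by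
    have hinv : (s / 2)⁻¹ = 2 * Real.exp (|x| + 1) := by
      rw [hs, inv_div, Real.exp_neg, div_inv_eq_mul]
    have := inv_one_sub_le_two_mul_mgf_id (t := 1 - s / 2) (by linarith) (by linarith)
    rw [sub_sub_cancel, hinv] at this
    linarith
  calc (1 - s / 2) * x ≤ (1 - s / 2) * |x| :=
        mul_le_mul_of_nonneg_left (le_abs_self x) (by linarith)
    _ ≤ |x| := mul_le_of_le_one_left (abs_nonneg x) (by linarith)
    _ < |x| + 1 := by linarith
    _ ≤ _ := (Real.le_log_iff_exp_le ((Real.exp_pos _).trans_le hmgf)).2 hmgf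

theorem surjOn_deriv_cgf_signedPow (hp : 0 < p) (hp1 : p ≤ 1) :
    Set.SurjOn (deriv (cgf (signedPow p) twoSidedExponential))
      (interior (integrableExpSet (signedPow p) twoSidedExponential)) Set.univ := by
  have hsymm := identDistrib_signedPow_neg p
  rcases hp1.eq_or_lt with rfl | hp1
  · rw [signedPow_one] at hsymm ⊢
    exact surjOn_deriv_cgf_of_identDistrib_neg hsymm exists_mul_lt_cgf_id
  · exact surjOn_deriv_cgf_of_unbounded hsymm (mem_integrableExpSet_signedPow hp hp1)
      (measureReal_le_signedPow_pos hp)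

theorem exp_div_two_le_measureReal_signedPow_preimage_Icc (hp : 0 < p) {a b : ℝ} (ha : 0 ≤ a)
    (hb : 0 ≤ b) (hab : a ^ p⁻¹ + 1 ≤ b ^ p⁻¹) :
    Real.exp (-(a ^ p⁻¹ + 1)) / 2 ≤
      twoSidedExponential.real (signedPow p ⁻¹' Set.Icc a b) := by
  have hroot : 0 ≤ a ^ p⁻¹ := by positivity
  refine (exp_div_two_le_measureReal_Icc hroot).trans (measureReal_mono fun y hy => ?_)
  have hy0 : 0 ≤ y := hroot.trans hy.1
  rw [Set.mem_preimage, signedPow_of_nonneg hp hy0, ← Real.rpow_inv_rpow ha hp.ne',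
    ← Real.rpow_inv_rpow hb hp.ne']
  exact ⟨Real.rpow_le_rpow hroot hy.1 hp.le, Real.rpow_le_rpow hy0 (hy.2.trans hab) hp.le⟩

theorem eventually_exp_le_measureReal_abs_signedPow_sub_le_of_nonneg (hp : 0 < p) {x δ c : ℝ}
    (hx : 0 ≤ x) (hδ : 0 < δ) (hc : x ^ p⁻¹ < c) :
    ∀ᶠ n : ℕ in atTop, Real.exp (-c * n ^ p⁻¹) ≤
      twoSidedExponential.real {y | |signedPow p y - n * x| ≤ n * δ} := by
  have hxδ : 0 ≤ x + δ := by linarith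
  have hspeed := tendsto_natCast_rpow_atTop (inv_pos.2 hp)
  have hgap : 0 < (x + δ) ^ p⁻¹ - x ^ p⁻¹ :=
    sub_pos.2 (Real.rpow_lt_rpow hx (by linarith) (inv_pos.2 hp))
  filter_upwards [(hspeed.const_mul_atTop hgap).eventually_ge_atTop 1,
    eventually_const_mul_exp_le hspeed (2 * Real.exp 1) (neg_lt_neg hc)] with n hn hexp
  calc Real.exp (-c * n ^ p⁻¹) ≤ Real.exp (-((n * x) ^ p⁻¹ + 1)) / 2 := by
        rw [Real.mul_rpow n.cast_nonneg hx, mul_comm (_ ^ _), le_div_iff₀ two_pos, neg_add,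
          ← neg_mul, Real.exp_add, Real.exp_neg 1, ← div_eq_mul_inv,
          le_div_iff₀ (Real.exp_pos 1)]
        linarith
    _ ≤ twoSidedExponential.real (signedPow p ⁻¹' Set.Icc (n * x) (n * (x + δ))) := by
        refine exp_div_two_le_measureReal_signedPow_preimage_Icc hp (by positivity)
          (by positivity) ?_
        rw [Real.mul_rpow n.cast_nonneg hx, Real.mul_rpow n.cast_nonneg hxδ]
        linarith
    _ ≤ _ := measureReal_mono fun y hy => by
        rw [Set.mem_ofPred_eq, abs_of_nonneg (sub_nonneg.2 hy.1)]
        linarith [hy.2]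

theorem eventually_exp_le_measureReal_abs_signedPow_sub_le (hp : 0 < p) {x δ c : ℝ} (hδ : 0 < δ)
    (hc : |x| ^ (1 / p) < c) :
    ∀ᶠ n : ℕ in atTop, Real.exp (-c * n ^ (1 / p)) ≤
      twoSidedExponential.real {y | |signedPow p y - n * x| ≤ n * δ} := by
  rw [one_div] at hc ⊢
  rcases le_total 0 x with hx | hx
  · rw [abs_of_nonneg hx] at hc
    exact eventually_exp_le_measureReal_abs_signedPow_sub_le_of_nonneg hp hx hδ hc
  · rw [abs_of_nonpos hx] at hc
    filter_upwards [eventually_exp_le_measureReal_abs_signedPow_sub_le_of_nonneg hp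
      (neg_nonneg.2 hx) hδ hc] with n hn
    have hflip : twoSidedExponential {y | |signedPow p y - n * x| ≤ n * δ} =
        twoSidedExponential {y | |-signedPow p y - n * x| ≤ n * δ} :=
      (identDistrib_signedPow_neg p).measure_mem_eq (s := {z | |z - n * x| ≤ n * δ})
        (measurableSet_le (by fun_prop) measurable_const)
    refine hn.trans_eq ?_
    rw [Measure.real, Measure.real, hflip]
    simp only [mul_neg, sub_neg_eq_add, neg_sub_left, abs_neg, add_comm]

end twoSidedExponential

theorem proposition1
    {Ω' : Type*} [MeasurableSpace Ω'] (P' : Measure Ω') [IsProbabilityMeasure P']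
    (Y : Ω' → ℝ) (hY : HasLaw Y twoSidedExponential P')
    (p : ℝ)
    {Ω : Type*} [MeasurableSpace Ω] (P : Measure Ω) [IsProbabilityMeasure P]
    (X : ℕ → Ω → ℝ) (hindep : iIndepFun X P)
    (hident : ∀ i, IdentDistrib (X i) (fun ω => signedPow p (Y ω)) P P') :
    (0 < p → p ≤ 1 →
      SatisfiesLDP P (empiricalMean X) (fun n => (n : ℝ))
        (legendre (freeEnergy P' fun ω => signedPow p (Y ω)))) ∧
    (1 < p →
      SatisfiesLDP P (empiricalMean X) (fun n => (n : ℝ) ^ (1 / p))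
        (fun x => ((|x| ^ (1 / p) : ℝ) : EReal))) := by
  have hYid : IdentDistrib (fun ω => signedPow p (Y ω)) (signedPow p) P' twoSidedExponential :=
    (hY.identDistrib HasLaw.id).comp (measurable_signedPow p)
  have hid i := (hident i).trans hYid
  refine ⟨fun hp hp1 => ?_, fun hp => ?_⟩
  · rw [freeEnergy_congr_identDistrib hYid]
    exact satisfiesLDP_empiricalMean_of_surjOn_deriv_cgf hindep hid
      (twoSidedExponential.integrable_signedPow hp)
      (twoSidedExponential.surjOn_deriv_cgf_signedPow hp hp1)
  · have hp0 : 0 < p := one_pos.trans hp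
    have hmean :=
      integral_eq_zero_of_identDistrib_neg (twoSidedExponential.identDistrib_signedPow_neg p)
    simpa only [one_mul] using satisfiesLDP_empiricalMean_of_stretchedExp hindep hid (κ := 1)
      (one_div_pos.2 hp0) ((div_lt_one hp0).2 hp) one_pos hmean
      (fun _ hθ => twoSidedExponential.integrable_exp_mul_abs_signedPow_rpow hp0 hθ)
      (fun _ _ hδ _ hc =>
        twoSidedExponential.eventually_exp_le_measureReal_abs_signedPow_sub_le hp0 hδ
          (by simpa only [one_mul] using hc))
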